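/- Let $R=\bigoplus_{i\in\mathbb{Z}}R_i$ be a commutative Noetherian $\mathbb{Z}$-graded ring such that $R_0$ is Artinian and the Krull dimension of $R$ is at most $2$. Assume that $R$ has a unique graded maximal ideal, that is, exactly one maximal ideal of $R$ is homogeneous. Let $M$ and $N$ be nonzero $\mathbb{Z}$-graded $R$-modules that have finite length as $R$-modules, and assume that the projective dimension $\operatorname{pd}_R M$ is finite. Then $\operatorname{Ext}^n_R(M,N)\neq 0$ for every integer $n$ with $0\le n\le \operatorname{pd}_R M$. -/

import Mathlib

universe u

open CategoryTheory

/-!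
The grading is used only to locate supports. If `M` is graded of finite length and `x` is
homogeneous of nonzero degree, then `1 + x` acts bijectively on `M`, which forces `x` to act
nilpotently (`exists_pow_mem_annihilator_of_mem`). So a prime containing the annihilator of `M`
contains every homogeneous element of nonzero degree; it is homogeneous, it is maximal, and hence it
is the unique graded maximal ideal `m`. Thus `M` and `N` are supported at `m` alone
(`IsSupportedAt`), and what remains is a statement about such modules of finite length.

Let `p` be the projective dimension of `M`.

* `p ≤ dim R_m`. This is a local question, and over a Noetherian local ring it follows from one
  half of the Auslander–Buchsbaum formula (`exists_add_eq_and_nontrivial_ext_residueField`) together with the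
  bound of the depth by the dimension (`exists_nontrivial_ext_residueField_of_supportDim_le`). So
  `p ≤ 2`, and `m` is not a minimal prime if `p > 0`.
* Degree `0`: both modules involve only the simple module `R ⧸ m`, so `Hom(M, N) ≠ 0`.
* Degree `p`: `Ext^p(M, -)` is right exact. If it vanished on `N` it would vanish on the quotient
  `R ⧸ m` of `N`, and then on all finite modules by Noetherian induction
  (`subsingleton_ext_of_subsingleton_ext_quotient`), contradicting the choice of `p`.
* Degree `1` when `p = 2`: the Euler characteristic `∑ (-1)ⁱ ℓ(Extⁱ(M, N))` is `ℓ(N)` times the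
  alternating sum of the ranks in a projective resolution of `M`. This sum can be computed at a prime
  strictly below `m`, where `M` vanishes, and so it is zero. Hence
  `ℓ(Ext¹(M, N)) = ℓ(Hom(M, N)) + ℓ(Ext²(M, N)) > 0`
  (`nontrivial_ext_one_of_hasProjectiveDimensionLE_two`).
-/

open Abelian

/-! ### Depth and projective dimension over a Noetherian local ring -/

section ExtVanishing

variable {C : Type*} [Category C] [Abelian C] [HasExt C] {S : ShortComplex C}

theorem CategoryTheory.ShortComplex.ShortExact.subsingleton_ext_X₂ (hS : S.ShortExact) (A : C)
    (n : ℕ) (h₁ : Subsingleton (Ext A S.X₁ n)) (h₃ : Subsingleton (Ext A S.X₃ n)) :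
    Subsingleton (Ext A S.X₂ n) := by
  refine subsingleton_of_forall_eq 0 fun x ↦ ?_
  obtain ⟨y, rfl⟩ := Ext.covariant_sequence_exact₂ A hS x (Subsingleton.elim _ _)
  rw [Subsingleton.elim y 0, Ext.zero_comp]

theorem CategoryTheory.ShortComplex.ShortExact.subsingleton_ext_X₃ (hS : S.ShortExact) (A : C)
    (n : ℕ) (h₂ : Subsingleton (Ext A S.X₂ n)) (h₁ : Subsingleton (Ext A S.X₁ (n + 1))) :
    Subsingleton (Ext A S.X₃ n) := by
  refine subsingleton_of_forall_eq 0 fun x ↦ ?_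
  obtain ⟨y, rfl⟩ := Ext.covariant_sequence_exact₃ A hS x rfl (Subsingleton.elim _ _)
  rw [Subsingleton.elim y 0, Ext.zero_comp]

end ExtVanishing

section Local

variable {R : Type u} [CommRing R] [IsNoetherianRing R] [IsLocalRing R]

open IsLocalRing

/-- A finite module without socle has a regular element in the maximal ideal. -/
theorem exists_isSMulRegular_of_subsingleton_ext_residueField (X : ModuleCat.{u} R)
    [Module.Finite R X]
    (h : Subsingleton (Ext (ModuleCat.of R (R ⧸ maximalIdeal R)) X 0)) :
    ∃ r ∈ maximalIdeal R, IsSMulRegular X r := by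
  have : Subsingleton ((R ⧸ maximalIdeal R) →ₗ[R] X) :=
    ((Ext.homEquiv₀ (X := ModuleCat.of R (R ⧸ maximalIdeal R)) (Y := X)).trans
      ModuleCat.homEquiv).symm.subsingleton
  obtain ⟨r, hr, hreg⟩ := IsSMulRegular.subsingleton_linearMap_iff.mp this
  rw [Ideal.annihilator_quotient] at hr
  exact ⟨r, hr, hreg⟩

/-- The depth of a finite module over a Noetherian local ring, measured by the first nonvanishing
`Ext` out of the residue field, is at most the dimension of its support: cutting by a regular
element lowers the dimension by one, and shifts `Ext` by at most one degree. -/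
theorem exists_nontrivial_ext_residueField_of_supportDim_le (e : ℕ) (X : ModuleCat.{u} R)
    [Module.Finite R X] [Nontrivial X] (h : Module.supportDim R X ≤ e) :
    ∃ i ≤ e, Nontrivial (Ext (ModuleCat.of R (R ⧸ maximalIdeal R)) X i) := by
  induction e generalizing X with
  | zero =>
    refine ⟨0, le_rfl, ?_⟩
    by_contra! hc
    obtain ⟨r, hr, hreg⟩ := exists_isSMulRegular_of_subsingleton_ext_residueField X hc
    have hn : Nontrivial (QuotSMulTop r X) := nontrivial_quotSMulTop_of_mem_maximalIdeal X hr
    rw [← Module.supportDim_quotSMulTop_succ_eq_supportDim hreg hr, Nat.cast_zero,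
      ENat.WithBot.add_one_le_zero_iff] at h
    exact Module.supportDim_ne_bot_of_nontrivial R (QuotSMulTop r X) h
  | succ e ih =>
    by_contra! hc
    obtain ⟨r, hr, hreg⟩ :=
      exists_isSMulRegular_of_subsingleton_ext_residueField X (hc 0 (Nat.zero_le _))
    have hn : Nontrivial (QuotSMulTop r X) := nontrivial_quotSMulTop_of_mem_maximalIdeal X hr
    obtain ⟨i, hi, hnt⟩ := ih (ModuleCat.of R (QuotSMulTop r X)) (by
      rw [← Module.supportDim_quotSMulTop_succ_eq_supportDim hreg hr] at h
      rw [← Nat.cast_one, Nat.cast_add] at h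
      exact ENat.WithBot.add_le_add_natCast_right_iff.mp h)
    rw [← not_subsingleton_iff_nontrivial] at hnt
    exact hnt (hreg.smulShortComplex_shortExact.subsingleton_ext_X₃ _ i
      (hc i (by lia)) (hc (i + 1) (by lia)))

/-- A finite module over a local ring has a presentation by a finite free module whose relations
have coefficients in the maximal ideal. -/
theorem exists_minimal_presentation {R : Type*} [CommRing R] [IsLocalRing R] (Z : Type*)
    [AddCommGroup Z] [Module R Z] [Module.Finite R Z] :
    ∃ (n : ℕ) (f : (Fin n → R) →ₗ[R] Z), Function.Surjective f ∧
      ∀ v, f v = 0 → ∀ i, v i ∈ maximalIdeal R := by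
  let b := Module.finBasis (ResidueField R) (TensorProduct R (ResidueField R) Z)
  have hs := (TensorProduct.mk_surjective R Z (ResidueField R) Ideal.Quotient.mk_surjective)
  choose z hz using fun i ↦ hs (b i)
  refine ⟨_, Fintype.linearCombination R z, ?_, fun v hv i ↦ ?_⟩
  · rw [← LinearMap.range_eq_top, Fintype.range_linearCombination]
    exact span_eq_top_of_tmul_eq_basis z b hz
  · have h : ∑ i, (residue R (v i)) • b i = 0 := by
      rw [Fintype.linearCombination_apply] at hv
      have := congr_arg (TensorProduct.mk R (ResidueField R) Z 1) hv
      simp only [map_sum, map_smul, map_zero, hz] at this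
      exact this
    have := Fintype.linearIndependent_iff.mp b.linearIndependent _ h i
    exact (residue_eq_zero_iff _).mp this

theorem ext_smul_eq_zero_of_mem_annihilator {R : Type u} [CommRing R] {A B : ModuleCat.{u} R}
    {r : R} (hr : r ∈ Module.annihilator R A) {n : ℕ} (x : Ext A B n) : r • x = 0 := by
  have h0 : r • 𝟙 A = 0 := by
    ext z
    exact Module.mem_annihilator.mp hr z
  have : r • x = (Ext.mk₀ (r • 𝟙 A)).comp x (zero_add n) := by simp [Ext.mk₀_smul]
  rw [this, h0, Ext.mk₀_zero, Ext.zero_comp]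

/-- A map out of a finite free module with values in `I • ⊤` induces zero on `Ext` out of a module
killed by `I`. -/
theorem ext_comp_mk₀_eq_zero_of_mem_smul_top {R : Type u} [CommRing R] {A P F : ModuleCat.{u} R}
    (I : Ideal R) (hA : I ≤ Module.annihilator R A) [Module.Free R P] [Module.Finite R P]
    (f : P ⟶ F) (hf : ∀ x, f.hom x ∈ (I • ⊤ : Submodule R F)) (n : ℕ) (x : Ext A P n) :
    x.comp (Ext.mk₀ f) (add_zero n) = 0 := by
  let b := Module.Free.chooseBasis R P
  have key (φ : P →ₗ[R] R) (y : F) (hy : y ∈ (I • ⊤ : Submodule R F)) :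
      x.comp (Ext.mk₀ (ModuleCat.ofHom (φ.smulRight y))) (add_zero n) = 0 := by
    induction hy using Submodule.smul_induction_on' with
    | smul r hr y hy =>
      have : ModuleCat.ofHom (φ.smulRight (r • y)) = r • ModuleCat.ofHom (φ.smulRight y) := by
        ext z
        simp [smul_comm r]
      rw [this, Ext.mk₀_smul, Ext.comp_smul]
      rw [← Ext.smul_comp, ext_smul_eq_zero_of_mem_annihilator (hA hr), Ext.zero_comp]
    | add y hy z hz h h' =>
      have : ModuleCat.ofHom (φ.smulRight (y + z)) =
          ModuleCat.ofHom (φ.smulRight y) + ModuleCat.ofHom (φ.smulRight z) := by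
        ext z
        simp
      rw [this, Ext.mk₀_add, Ext.comp_add, h, h', add_zero]
  have : f = ∑ i, ModuleCat.ofHom ((b.coord i).smulRight (f.hom (b i))) := by
    apply ModuleCat.hom_ext
    rw [ModuleCat.hom_sum]
    apply b.ext
    intro i
    simp [LinearMap.sum_apply, Finsupp.single_apply, ite_smul]
  rw [this, Ext.mk₀_sum, Ext.comp_sum]
  exact Finset.sum_eq_zero fun i _ ↦ key _ _ (hf _)

theorem subsingleton_ext_of_free {R : Type u} [CommRing R] {A F : ModuleCat.{u} R}
    [Module.Free R F] [Module.Finite R F] (n : ℕ)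
    (h : Subsingleton (Ext A (ModuleCat.of R R) n)) : Subsingleton (Ext A F n) := by
  refine subsingleton_of_forall_eq 0 fun x ↦ ?_
  let b := Module.Free.chooseBasis R F
  -- The identity of `F` is a sum of maps that factor through `R`.
  have : 𝟙 F = ∑ i, ModuleCat.ofHom (b.coord i) ≫
      ModuleCat.ofHom (LinearMap.toSpanSingleton R F (b i)) := by
    apply ModuleCat.hom_ext
    rw [ModuleCat.hom_sum]
    apply b.ext
    intro i
    simp [LinearMap.sum_apply, Finsupp.single_apply, ite_smul]
  rw [← Ext.comp_mk₀_id x, this, Ext.mk₀_sum, Ext.comp_sum]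
  refine Finset.sum_eq_zero fun i _ ↦ ?_
  rw [← Ext.mk₀_comp_mk₀, ← Ext.comp_assoc_of_second_deg_zero,
    Subsingleton.elim (x.comp _ _) 0, Ext.zero_comp]

/-- One half of the Auslander–Buchsbaum formula: if `d` is the depth of `R` and `Z` is a finite
module of projective dimension `p`, then `p ≤ d` and the depth of `Z` is at most `d - p`. The proof
passes to the syzygy in a minimal presentation, which lowers `p` and raises the degree by one. -/
theorem exists_add_eq_and_nontrivial_ext_residueField {d : ℕ}
    (hd : ∀ i < d, Subsingleton (Ext (ModuleCat.of R (R ⧸ maximalIdeal R)) (ModuleCat.of R R) i))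
    (hd' : Nontrivial (Ext (ModuleCat.of R (R ⧸ maximalIdeal R)) (ModuleCat.of R R) d))
    (p : ℕ) (Z : ModuleCat.{u} R) [Module.Finite R Z] (hZ : HasProjectiveDimensionLE Z p)
    (hZ' : ¬ HasProjectiveDimensionLT Z p) :
    ∃ j, j + p = d ∧ Nontrivial (Ext (ModuleCat.of R (R ⧸ maximalIdeal R)) Z j) := by
  induction p generalizing Z with
  | zero =>
    refine ⟨d, rfl, ?_⟩
    rw [HasProjectiveDimensionLE, zero_add, ← projective_iff_hasProjectiveDimensionLT_one,
      ← IsProjective.iff_projective] at hZ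
    have : Module.Free R Z := Module.free_of_flat_of_isLocalRing
    rw [hasProjectiveDimensionLT_zero_iff_isZero, ModuleCat.isZero_iff_subsingleton,
      not_subsingleton_iff_nontrivial] at hZ'
    let b := Module.Free.chooseBasis R Z
    obtain ⟨i⟩ := b.index_nonempty
    let r : Retract (ModuleCat.of R R) Z :=
      { i := ModuleCat.ofHom (LinearMap.toSpanSingleton R Z (b i))
        r := ModuleCat.ofHom (b.coord i)
        retract := by
          apply ModuleCat.hom_ext
          ext
          simp }
    obtain ⟨x, hx⟩ := exists_ne (0 : Ext (ModuleCat.of R (R ⧸ maximalIdeal R)) (ModuleCat.of R R) d)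
    refine ⟨x.comp (Ext.mk₀ r.i) (add_zero d), 0, fun h ↦ hx ?_⟩
    rw [← Ext.comp_mk₀_id x, ← r.retract, ← Ext.mk₀_comp_mk₀,
      ← Ext.comp_assoc_of_second_deg_zero, h, Ext.zero_comp]
  | succ p ih =>
    obtain ⟨n, f, hf, hker⟩ := exists_minimal_presentation Z (R := R)
    have hS := LinearMap.shortExact_shortComplexKer hf
    have hproj : Projective (ModuleCat.of R (Fin n → R)) :=
      ModuleCat.projective_of_categoryTheory_projective _
    have hK : HasProjectiveDimensionLE (ModuleCat.of R (LinearMap.ker f)) p :=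
      (hS.hasProjectiveDimensionLT_X₃_iff p hproj).mp hZ
    have hK' : ¬ HasProjectiveDimensionLT (ModuleCat.of R (LinearMap.ker f)) p := fun h ↦
      hZ' (hS.hasProjectiveDimensionLT_X₃ p h inferInstance)
    obtain ⟨j, hj, hnt⟩ := ih _ hK hK'
    -- The inclusion of the syzygy induces zero in degree `j`: for `j < d` the target vanishes, and
    -- for `j = d` the syzygy is free and lies in `m F`.
    have hzero (x : Ext (ModuleCat.of R (R ⧸ maximalIdeal R))
        (ModuleCat.of R (LinearMap.ker f)) j) :
        x.comp (Ext.mk₀ f.shortComplexKer.f) (add_zero j) = 0 := by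
      rcases Nat.eq_zero_or_pos p with rfl | hp
      · rw [HasProjectiveDimensionLE, zero_add, ← projective_iff_hasProjectiveDimensionLT_one,
          ← IsProjective.iff_projective] at hK
        have : Module.Free R (LinearMap.ker f) := Module.free_of_flat_of_isLocalRing
        refine ext_comp_mk₀_eq_zero_of_mem_smul_top (maximalIdeal R)
          (Ideal.annihilator_quotient (I := maximalIdeal R)).ge _ (fun y ↦ ?_) j x
        have hy : (y : Fin n → R) = ∑ i, (y : Fin n → R) i • Pi.single i (1 : R) := by
          simpa [← Pi.basisFun_apply] using ((Pi.basisFun R (Fin n)).sum_repr y.1).symm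
        change (y : Fin n → R) ∈ _
        rw [hy]
        exact Submodule.sum_mem _ fun i _ ↦
          Submodule.smul_mem_smul (hker _ y.2 i) Submodule.mem_top
      · have := subsingleton_ext_of_free (F := ModuleCat.of R (Fin n → R)) j (hd j (by lia))
        exact Subsingleton.elim _ _
    obtain ⟨x, hx⟩ := exists_ne (0 : Ext (ModuleCat.of R (R ⧸ maximalIdeal R))
        (ModuleCat.of R (LinearMap.ker f)) j)
    cases j with
    | zero =>
      have := hS.mono_f
      refine absurd ?_ hx
      apply Ext.postcomp_mk₀_injective_of_mono _ f.shortComplexKer.f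
      simpa using hzero x
    | succ j =>
      obtain ⟨y, hy⟩ := Ext.covariant_sequence_exact₁ _ hS x (hzero x) rfl
      refine ⟨j, by lia, y, 0, ?_⟩
      rintro rfl
      exact hx (by rw [← hy, Ext.zero_comp])

/-- A finite projective dimension exceeding `e` is attained exactly by some `p > e`. -/
theorem exists_not_hasProjectiveDimensionLT {C : Type*} [Category C] [Abelian C] {X : C} {q : ℕ}
    (hX : HasProjectiveDimensionLE X q) {e : ℕ} (he : ¬ HasProjectiveDimensionLE X e) :
    ∃ p, e < p ∧ HasProjectiveDimensionLE X p ∧ ¬ HasProjectiveDimensionLT X p := by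
  classical
  have hex : ∃ n, HasProjectiveDimensionLE X n := ⟨q, hX⟩
  have hlt : e < Nat.find hex := by
    by_contra! h
    have := Nat.find_spec hex
    exact he (hasProjectiveDimensionLT_of_ge X _ _ (Nat.succ_le_succ h))
  refine ⟨Nat.find hex, hlt, Nat.find_spec hex, fun h ↦ ?_⟩
  refine Nat.find_min hex (m := Nat.find hex - 1) (by lia) ?_
  rwa [HasProjectiveDimensionLE, Nat.sub_add_cancel (by lia)]

/-- Over a Noetherian local ring, a finite projective dimension is at most the Krull dimension. -/
theorem hasProjectiveDimensionLE_of_ringKrullDim_le {e q : ℕ} (he : ringKrullDim R ≤ e)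
    (Z : ModuleCat.{u} R) [Module.Finite R Z] (hZ : HasProjectiveDimensionLE Z q) :
    HasProjectiveDimensionLE Z e := by
  classical
  by_contra hc
  obtain ⟨p, hep, hp, hp'⟩ := exists_not_hasProjectiveDimensionLT hZ hc
  obtain ⟨i, hi, hnt⟩ := exists_nontrivial_ext_residueField_of_supportDim_le e (ModuleCat.of R R)
    ((Module.supportDim_self_eq_ringKrullDim (R := R)).trans_le he)
  have hex : ∃ i, Nontrivial (Ext (ModuleCat.of R (R ⧸ maximalIdeal R)) (ModuleCat.of R R) i) :=
    ⟨i, hnt⟩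
  obtain ⟨j, hj, -⟩ := exists_add_eq_and_nontrivial_ext_residueField (d := Nat.find hex)
    (fun i hi ↦ not_nontrivial_iff_subsingleton.mp (Nat.find_min hex hi)) (Nat.find_spec hex)
    p Z hp hp'
  have := Nat.find_min' hex hnt
  lia

end Local

/-! ### Modules supported at a single maximal ideal -/

section Support

open scoped Pointwise

variable {R : Type u} [CommRing R]

/-- Every prime ideal containing the annihilator of `M` equals `m`. For a finite module `M` this
says that the support of `M` is contained in `{m}`. -/
def IsSupportedAt (m : Ideal R) (M : Type*) [AddCommGroup M] [Module R M] : Prop :=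
  ∀ P : Ideal R, P.IsPrime → Module.annihilator R M ≤ P → P = m

namespace IsSupportedAt

variable {m : Ideal R} {M : Type u} [AddCommGroup M] [Module R M]

theorem exists_pow_mem_annihilator (h : IsSupportedAt m M) {a : R} (ha : a ∈ m) :
    ∃ k : ℕ, a ^ k ∈ Module.annihilator R M := by
  change a ∈ (Module.annihilator R M).radical
  rw [Ideal.radical_eq_sInf, Submodule.mem_sInf]
  rintro P ⟨hP, hP'⟩
  exact h P hP' hP ▸ ha

theorem subsingleton_localizedModule [Module.Finite R M] (h : IsSupportedAt m M) {q : Ideal R}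
    [hq : q.IsPrime] (hqm : q ≠ m) : Subsingleton (LocalizedModule q.primeCompl M) := by
  have : (⟨q, hq⟩ : PrimeSpectrum R) ∉ Module.support R M := by
    rw [Module.mem_support_iff_of_finite]
    exact fun h' ↦ hqm (h q hq h')
  exact Module.notMem_support_iff.mp this

theorem exists_surjective_quotient [Module.Finite R M] [Nontrivial M] (h : IsSupportedAt m M) :
    ∃ g : M →ₗ[R] R ⧸ m, Function.Surjective g := by
  obtain ⟨K, hK, -⟩ := (eq_top_or_exists_le_coatom (⊥ : Submodule R M)).resolve_left bot_ne_top
  have : IsSimpleModule R (M ⧸ K) := isSimpleModule_iff_isCoatom.mpr hK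
  obtain ⟨I, hI, ⟨e⟩⟩ := isSimpleModule_iff_quot_maximal.mp this
  obtain rfl : I = m := h I hI.isPrime (by
    rw [← Ideal.annihilator_quotient (I := I), ← e.annihilator_eq]
    exact K.mkQ.annihilator_le_of_surjective K.mkQ_surjective)
  exact ⟨e.toLinearMap ∘ₗ K.mkQ, e.surjective.comp K.mkQ_surjective⟩

/-- Nonzero finite modules supported at the same maximal ideal admit a nonzero map. -/
theorem nontrivial_linearMap [IsNoetherianRing R] [Module.Finite R M] [Nontrivial M]
    {N : Type u} [AddCommGroup N] [Module R N] [Module.Finite R N] [Nontrivial N]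
    (hM : IsSupportedAt m M) (hN : IsSupportedAt m N) :
    Nontrivial (M →ₗ[R] N) := by
  by_contra! hc
  obtain ⟨r, hr, hreg⟩ := IsSMulRegular.subsingleton_linearMap_iff.mp hc
  have hann : Module.annihilator R M ≠ ⊤ := by
    rw [Ne, Module.annihilator_eq_top_iff, not_subsingleton_iff_nontrivial]
    infer_instance
  obtain ⟨P, hP, hle⟩ := Ideal.exists_le_maximal _ hann
  have hrm : r ∈ m := hM P hP.isPrime hle ▸ hle hr
  obtain ⟨k, hk⟩ := hN.exists_pow_mem_annihilator hrm
  obtain ⟨x, hx⟩ := exists_ne (0 : N)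
  refine hx ((hreg.pow k) ?_)
  simpa using Module.mem_annihilator.mp hk x

/-- A finite projective dimension of a module supported at `m` is at most the height of `m`. -/
theorem hasProjectiveDimensionLE_of_ringKrullDim_le [IsNoetherianRing R] [Module.Finite R M]
    [hm : m.IsMaximal] (h : IsSupportedAt m M) {e q : ℕ}
    (he : ringKrullDim (Localization.AtPrime m) ≤ e)
    (hM : HasProjectiveDimensionLE (ModuleCat.of R M) q) :
    HasProjectiveDimensionLE (ModuleCat.of R M) e := by
  rw [ModuleCat.hasProjectiveDimensionLE_iff_forall_maximalSpectrum] at hM ⊢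
  rintro ⟨n, hn⟩
  by_cases hnm : n = m
  · subst hnm
    have := ModuleCat.localizedModule_isLocalizedModule (ModuleCat.of R M) n.primeCompl
    have : Module.Finite (Localization.AtPrime n)
        ((ModuleCat.of R M).localizedModule n.primeCompl) :=
      Module.Finite.of_isLocalizedModule n.primeCompl
        ((ModuleCat.of R M).localizedModuleMkLinearMap n.primeCompl)
    exact _root_.hasProjectiveDimensionLE_of_ringKrullDim_le he _ (hM ⟨n, hn⟩)
  · have hs : Subsingleton (LocalizedModule n.primeCompl M) := h.subsingleton_localizedModule hnm
    have : Subsingleton ((ModuleCat.of R M).localizedModule n.primeCompl) :=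
      (equivShrink (LocalizedModule n.primeCompl M)).symm.subsingleton
    have := (ModuleCat.isZero_of_subsingleton
      ((ModuleCat.of R M).localizedModule n.primeCompl)).hasProjectiveDimensionLT_zero
    exact hasProjectiveDimensionLT_of_ge _ 0 _ (Nat.zero_le _)

end IsSupportedAt

/-- In the top degree, `Ext A -` is right exact. -/
theorem exists_ext_comp_mk₀_eq_of_surjective {A : ModuleCat.{u} R} {p : ℕ}
    (hA : HasProjectiveDimensionLE A p) {X Y : Type u} [AddCommGroup X] [Module R X]
    [AddCommGroup Y] [Module R Y] (g : X →ₗ[R] Y) (hg : Function.Surjective g)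
    (y : Ext A (ModuleCat.of R Y) p) :
    ∃ x : Ext A (ModuleCat.of R X) p, x.comp (Ext.mk₀ (ModuleCat.ofHom g)) (add_zero p) = y :=
  Ext.covariant_sequence_exact₃ A (LinearMap.shortExact_shortComplexKer hg) y rfl
    (Ext.eq_zero_of_hasProjectiveDimensionLT _ (p + 1) le_rfl)

theorem subsingleton_ext_of_surjective {A : ModuleCat.{u} R} {p : ℕ}
    (hA : HasProjectiveDimensionLE A p) {X Y : Type u} [AddCommGroup X] [Module R X]
    [AddCommGroup Y] [Module R Y] (g : X →ₗ[R] Y) (hg : Function.Surjective g)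
    (h : Subsingleton (Ext A (ModuleCat.of R X) p)) :
    Subsingleton (Ext A (ModuleCat.of R Y) p) := by
  refine subsingleton_of_forall_eq 0 fun y ↦ ?_
  obtain ⟨x, rfl⟩ := exists_ext_comp_mk₀_eq_of_surjective hA g hg y
  rw [Subsingleton.elim x 0, Ext.zero_comp]

/-- If the top `Ext` vanishes on `X / aX` then it is divisible by `a` on `X`. -/
theorem exists_smul_eq_of_subsingleton_ext_quotSMulTop {A : ModuleCat.{u} R} {p : ℕ}
    (hA : HasProjectiveDimensionLE A p) {X : Type u} [AddCommGroup X] [Module R X] (a : R)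
    (h : Subsingleton (Ext A (ModuleCat.of R (QuotSMulTop a X)) p))
    (x : Ext A (ModuleCat.of R X) p) : ∃ z, a • z = x := by
  let f : X →ₗ[R] X := LinearMap.lsmul R X a
  let S := ModuleCat.shortComplexOfCompEqZero (LinearMap.range f).subtype (LinearMap.range f).mkQ
    (by ext; simp)
  have hS : S.ShortExact :=
    { exact := ModuleCat.shortComplex_exact _ fun y ↦ by simp [S]
      mono_f := (ModuleCat.mono_iff_injective _).mpr (Submodule.injective_subtype _)
      epi_g := (ModuleCat.epi_iff_surjective _).mpr (Submodule.mkQ_surjective _) }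
  have h' : Subsingleton (Ext A S.X₃ p) :=
    subsingleton_ext_of_surjective hA
      (Submodule.mapQ (a • ⊤ : Submodule R X) (LinearMap.range f) LinearMap.id (by
        rintro _ ⟨y, -, rfl⟩
        exact ⟨y, rfl⟩))
      (fun y ↦ by
        obtain ⟨y, rfl⟩ := Submodule.mkQ_surjective _ y
        exact ⟨Submodule.Quotient.mk y, rfl⟩) h
  obtain ⟨y, rfl⟩ := Ext.covariant_sequence_exact₂ A hS x (Subsingleton.elim _ _)
  obtain ⟨z, rfl⟩ := exists_ext_comp_mk₀_eq_of_surjective hA f.rangeRestrict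
    f.surjective_rangeRestrict y
  refine ⟨z, ?_⟩
  rw [Ext.comp_assoc_of_second_deg_zero, Ext.mk₀_comp_mk₀, Ext.smul_eq_comp_mk₀]
  rfl

/-- If `A` is supported at `m` and its top `Ext` vanishes on `R ⧸ m`, then it vanishes on every
finite module. Noetherian induction on the kernel of a surjection `L → Q`: if some `a ∈ m` does not
kill `Q` then the top `Ext` on `Q` is `a`-divisible and `a`-power torsion; otherwise every cyclic
submodule of `Q` is a quotient of `R ⧸ m`. -/
theorem subsingleton_ext_of_subsingleton_ext_quotient [IsNoetherianRing R] {m : Ideal R}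
    {A : ModuleCat.{u} R} (hAm : IsSupportedAt m A) {p : ℕ} (hA : HasProjectiveDimensionLE A p)
    (h : Subsingleton (Ext A (ModuleCat.of R (R ⧸ m)) p)) (L : ModuleCat.{u} R)
    [Module.Finite R L] : Subsingleton (Ext A L p) := by
  suffices H : ∀ (K : Submodule R L) (Q : Type u) [AddCommGroup Q] [Module R Q]
      (g : L →ₗ[R] Q), Function.Surjective g → LinearMap.ker g = K →
      Subsingleton (Ext A (ModuleCat.of R Q) p) from
    H _ L LinearMap.id Function.surjective_id rfl
  intro K
  induction K using WellFoundedGT.induction with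
  | ind K ih =>
    rintro Q _ _ g hg rfl
    -- The induction hypothesis applies to proper quotients of `Q`.
    have ihQ (T : Submodule R Q) (y : Q) (hy : y ∈ T) (hy0 : y ≠ 0) :
        Subsingleton (Ext A (ModuleCat.of R (Q ⧸ T)) p) := by
      refine ih _ (lt_of_le_of_ne (LinearMap.ker_le_ker_comp g T.mkQ) fun he ↦ ?_) (Q ⧸ T)
        (T.mkQ ∘ₗ g) (T.mkQ_surjective.comp hg) rfl
      obtain ⟨x, rfl⟩ := hg y
      refine hy0 (LinearMap.mem_ker.mp (he ▸ ?_))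
      simpa using hy
    by_cases hmQ : ∃ a ∈ m, ∃ y : Q, a • y ≠ 0
    · obtain ⟨a, ha, y, hy⟩ := hmQ
      have hdiv := exists_smul_eq_of_subsingleton_ext_quotSMulTop hA a
        (ihQ (a • ⊤) (a • y) (Submodule.smul_mem_pointwise_smul _ _ _ Submodule.mem_top) hy)
      obtain ⟨k, hk⟩ := hAm.exists_pow_mem_annihilator ha
      have hdivk (n : ℕ) (x : Ext A (ModuleCat.of R Q) p) : ∃ z, a ^ n • z = x := by
        induction n generalizing x with
        | zero => exact ⟨x, by simp⟩
        | succ n ihn =>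
          obtain ⟨z, rfl⟩ := ihn x
          obtain ⟨w, rfl⟩ := hdiv z
          exact ⟨w, by rw [pow_succ, mul_smul]⟩
      refine subsingleton_of_forall_eq 0 fun x ↦ ?_
      obtain ⟨z, rfl⟩ := hdivk k x
      exact ext_smul_eq_zero_of_mem_annihilator hk z
    · push Not at hmQ
      rcases subsingleton_or_nontrivial Q with hQ | hQ
      · have hz : Limits.IsZero (ModuleCat.of R Q) := ModuleCat.isZero_of_subsingleton _
        refine subsingleton_of_forall_eq 0 fun x ↦ ?_
        rw [← Ext.comp_mk₀_id x, hz.eq_of_src (𝟙 _) 0, Ext.mk₀_zero, Ext.comp_zero]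
      · obtain ⟨y, hy⟩ := exists_ne (0 : Q)
        let T : Submodule R Q := LinearMap.range (LinearMap.toSpanSingleton R Q y)
        let S := ModuleCat.shortComplexOfCompEqZero T.subtype T.mkQ (by ext; simp)
        have hS : S.ShortExact :=
          { exact := ModuleCat.shortComplex_exact _ fun y ↦ by simp [S]
            mono_f := (ModuleCat.mono_iff_injective _).mpr (Submodule.injective_subtype _)
            epi_g := (ModuleCat.epi_iff_surjective _).mpr (Submodule.mkQ_surjective _) }
        refine hS.subsingleton_ext_X₂ A p ?_ (ihQ T y ⟨1, by simp⟩ hy)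
        refine subsingleton_ext_of_surjective hA
          (Submodule.liftQ m (LinearMap.toSpanSingleton R Q y).rangeRestrict fun a ha ↦ ?_)
          ?_ h
        · exact Subtype.ext (by simpa using hmQ a ha y)
        · intro t
          obtain ⟨r, rfl⟩ := LinearMap.surjective_rangeRestrict _ t
          exact ⟨Submodule.Quotient.mk r, rfl⟩

/-- For `A` and `N` nonzero, finite and supported at `m`, the top `Ext` of `A` does not vanish
on `N`. -/
theorem nontrivial_ext_of_isSupportedAt [IsNoetherianRing R] {m : Ideal R}
    {A : ModuleCat.{u} R} [Module.Finite R A] (hAm : IsSupportedAt m A) {p : ℕ}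
    (hA : HasProjectiveDimensionLE A p) (hA' : ¬ HasProjectiveDimensionLT A p)
    {N : Type u} [AddCommGroup N] [Module R N] [Module.Finite R N] [Nontrivial N]
    (hN : IsSupportedAt m N) : Nontrivial (Ext A (ModuleCat.of R N) p) := by
  by_contra! hc
  obtain ⟨g, hg⟩ := hN.exists_surjective_quotient
  exact hA' (ModuleCat.hasProjectiveDimensionLT_of_forall_finite A p fun L _ ↦
    subsingleton_ext_of_subsingleton_ext_quotient hAm hA
      (subsingleton_ext_of_surjective hA g hg hc) L)

end Support

/-! ### Ranks and lengths of `Hom` modules -/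

section EulerCharacteristic

variable {R : Type u} [CommRing R]

open Module in
/-- The rank at a prime is additive on a short exact sequence that ends, at this prime, in free
modules. -/
theorem rankAtStalk_eq_add_of_exact {A B C : Type*} [AddCommGroup A] [AddCommGroup B]
    [AddCommGroup C] [Module R A] [Module R B] [Module R C] (q : PrimeSpectrum R)
    {f : A →ₗ[R] B} {g : B →ₗ[R] C} (hf : Function.Injective f) (hg : Function.Surjective g)
    (hfg : Function.Exact f g) [Module.Finite R A] [Module.Finite R C]
    [Module.Free (Localization.AtPrime q.asIdeal) (LocalizedModule q.asIdeal.primeCompl A)]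
    [Module.Free (Localization.AtPrime q.asIdeal) (LocalizedModule q.asIdeal.primeCompl C)] :
    rankAtStalk B q = rankAtStalk A q + rankAtStalk C q := by
  let f' := LocalizedModule.map q.asIdeal.primeCompl f
  let g' := LocalizedModule.map q.asIdeal.primeCompl g
  have hf' : Function.Injective f' := LocalizedModule.map_injective _ f hf
  have hg' : Function.Surjective g' := LocalizedModule.map_surjective _ g hg
  have hfg' : Function.Exact f' g' := LocalizedModule.map_exact q.asIdeal.primeCompl f g hfg
  obtain ⟨l, hl⟩ := Module.projective_lifting_property g' LinearMap.id hg'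
  obtain ⟨e, -⟩ := hfg'.splitSurjectiveEquiv hf' ⟨l, hl⟩
  rw [rankAtStalk, e.finrank_eq, Module.finrank_prod]
  rfl

/-- For a finite projective module `P`, the length of `Hom(P, R ⧸ m)` is the rank of `P` at `m`. -/
theorem length_linearMap_quotient (m : Ideal R) [hm : m.IsMaximal] (P : Type*) [AddCommGroup P]
    [Module R P] [Module.Finite R P] [Module.Projective R P] :
    Module.length R (P →ₗ[R] R ⧸ m) =
      Module.rankAtStalk P (⟨m, hm.isPrime⟩ : PrimeSpectrum R) := by
  let _ : Field (R ⧸ m) := Ideal.Quotient.field m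
  have hcomap : PrimeSpectrum.comap (algebraMap R (R ⧸ m)) ⊥ = ⟨m, hm.isPrime⟩ := by
    ext x
    simp [Ideal.Quotient.eq_zero_iff_mem]
  rw [Module.length_eq_of_surjective (R := R ⧸ m) (S := R) Ideal.Quotient.mk_surjective,
    (LinearMap.liftBaseChangeEquiv (R ⧸ m) (M := P) (N := R ⧸ m) (R := R)).length_eq,
    Module.length_eq_finrank, ← hcomap, ← Module.rankAtStalk_baseChange,
    Module.rankAtStalk_eq_finrank_of_free]
  congr 1
  exact Subspace.dual_finrank_eq

/-- For `P` finite projective and `N` of finite length supported at `m`,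
`ℓ(Hom(P, N)) = rank_m(P) ℓ(N)`. -/
theorem length_linearMap_eq_rankAtStalk_mul {m : Ideal R} [hm : m.IsMaximal] (P : Type*)
    [AddCommGroup P] [Module R P] [Module.Finite R P] [Module.Projective R P] {N : Type u}
    [AddCommGroup N] [Module R N] (hN : IsFiniteLength R N) (hNm : IsSupportedAt m N) :
    Module.length R (P →ₗ[R] N) =
      Module.rankAtStalk P (⟨m, hm.isPrime⟩ : PrimeSpectrum R) * Module.length R N := by
  induction hN with
  | of_subsingleton => simp
  | @of_simple_quotient N _ _ K _ _ ih =>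
    have hK : IsSupportedAt m K := fun P hP hle ↦
      hNm P hP ((K.subtype.annihilator_le_of_injective K.injective_subtype).trans hle)
    obtain ⟨I, hI, ⟨e⟩⟩ := isSimpleModule_iff_quot_maximal.mp
      (inferInstance : IsSimpleModule R (N ⧸ K))
    obtain rfl : I = m := hNm I hI.isPrime (by
      rw [← Ideal.annihilator_quotient (I := I), ← e.annihilator_eq]
      exact K.mkQ.annihilator_le_of_surjective K.mkQ_surjective)
    have h1 := Module.length_eq_add_of_exact
      (K.subtype.compRight R (M := P)) (K.mkQ.compRight R (M := P))
      (fun x y h ↦ by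
        ext z
        exact congr_arg Subtype.val (Subtype.ext (LinearMap.congr_fun h z)))
      (fun h ↦ Module.projective_lifting_property _ h K.mkQ_surjective)
      (fun h ↦ by
        constructor
        · intro h0
          refine ⟨h.codRestrict K fun z ↦ ?_, by ext; rfl⟩
          simpa using LinearMap.congr_fun h0 z
        · rintro ⟨h, rfl⟩
          ext z
          simp)
    have h2 := Module.length_eq_add_of_exact K.subtype K.mkQ K.injective_subtype K.mkQ_surjective
      (LinearMap.exact_subtype_mkQ K)
    rw [h1, h2, ih hK, mul_add,
      (LinearEquiv.congrRight e : (P →ₗ[R] N ⧸ K) ≃ₗ[R] (P →ₗ[R] R ⧸ I)).length_eq,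
      length_linearMap_quotient, Module.length_eq_one R (N ⧸ K), mul_one]

/-- If `Ext¹(M, N) = 0` then maps to `N` extend along the kernel of a surjection onto `M`. -/
theorem exists_comp_subtype_eq_of_subsingleton_ext_one {M N P : Type u} [AddCommGroup M]
    [Module R M] [AddCommGroup N] [Module R N] [AddCommGroup P] [Module R P] (f : P →ₗ[R] M)
    (hf : Function.Surjective f)
    (h : Subsingleton (Ext (ModuleCat.of R M) (ModuleCat.of R N) 1))
    (φ : LinearMap.ker f →ₗ[R] N) : ∃ ψ : P →ₗ[R] N, ψ ∘ₗ (LinearMap.ker f).subtype = φ := by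
  obtain ⟨x, hx⟩ := Ext.contravariant_sequence_exact₁ (LinearMap.shortExact_shortComplexKer hf)
    (ModuleCat.of R N) (Ext.mk₀ (ModuleCat.ofHom φ)) (add_zero 1) (Subsingleton.elim _ _)
  obtain ⟨ψ, rfl⟩ := (Ext.mk₀_bijective _ _).2 x
  rw [Ext.mk₀_comp_mk₀] at hx
  have := (Ext.mk₀_bijective _ _).1 hx
  exact ⟨ψ.hom, congr_arg ModuleCat.Hom.hom this⟩

theorem length_le_add_of_exact {A B C : Type*} [AddCommGroup A] [AddCommGroup B]
    [AddCommGroup C] [Module R A] [Module R B] [Module R C]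
    {f : A →ₗ[R] B} {g : B →ₗ[R] C} (hf : Function.Injective f) (hfg : Function.Exact f g) :
    Module.length R B ≤ Module.length R A + Module.length R C := by
  rw [Module.length_eq_add_of_exact f g.rangeRestrict hf g.surjective_rangeRestrict]
  · gcongr
    exact Module.length_le_of_injective _ (Submodule.injective_subtype _)
  · intro x
    rw [← hfg x, ← LinearMap.mem_ker, LinearMap.ker_rangeRestrict, LinearMap.mem_ker]

/-- The case of projective dimension two. If `0 → K → P₁ → P₀ → M → 0` is a projective resolution,
then the rank of `P₁` is the sum of the ranks of `K` and `P₀`, since `M` vanishes at the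
nonmaximal prime `q`. Hence the Euler characteristic `∑ (-1)ⁱ ℓ(Hom(Pᵢ, N))` vanishes; if
`Ext¹(M, N)` were zero, this Euler characteristic would be at least `ℓ(Hom(M, N)) > 0`. -/
theorem nontrivial_ext_one_of_hasProjectiveDimensionLE_two [IsNoetherianRing R] {m q : Ideal R}
    [hm : m.IsMaximal] [hq : q.IsPrime] (hqm : q < m) {M N : Type u} [AddCommGroup M]
    [Module R M] [AddCommGroup N] [Module R N] [Nontrivial M] [Nontrivial N] [Module.Finite R M]
    (hMm : IsSupportedAt m M) (hNm : IsSupportedAt m N) (hN : IsFiniteLength R N)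
    (hM : HasProjectiveDimensionLE (ModuleCat.of R M) 2) :
    Nontrivial (Ext (ModuleCat.of R M) (ModuleCat.of R N) 1) := by
  by_contra! hext
  obtain ⟨P₀, _, _, _, _, f₀, hf₀⟩ := Module.exists_finite_presentation R M
  obtain ⟨P₁, _, _, _, _, f₁, hf₁⟩ := Module.exists_finite_presentation R (LinearMap.ker f₀)
  have hKproj : Module.Projective R (LinearMap.ker f₁) := by
    have h₁ : HasProjectiveDimensionLE (ModuleCat.of R (LinearMap.ker f₀)) 1 :=
      ((LinearMap.shortExact_shortComplexKer hf₀).hasProjectiveDimensionLT_X₃_iff 1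
        (ModuleCat.projective_of_categoryTheory_projective (ModuleCat.of R P₀))).mp hM
    have h₂ : HasProjectiveDimensionLT (ModuleCat.of R (LinearMap.ker f₁)) 1 :=
      ((LinearMap.shortExact_shortComplexKer hf₁).hasProjectiveDimensionLT_X₃_iff 0
        (ModuleCat.projective_of_categoryTheory_projective (ModuleCat.of R P₁))).mp h₁
    rw [← projective_iff_hasProjectiveDimensionLT_one] at h₂
    exact (IsProjective.iff_projective _).mpr h₂
  have hex₀ := LinearMap.exact_subtype_ker_map f₀
  have hex₁ := LinearMap.exact_subtype_ker_map f₁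
  -- At `q` the first syzygy agrees with `P₀`, because `M` vanishes there.
  have hM0 : Subsingleton (LocalizedModule q.primeCompl M) :=
    hMm.subsingleton_localizedModule hqm.ne
  let e : LocalizedModule q.primeCompl (LinearMap.ker f₀) ≃ₗ[Localization.AtPrime q]
      LocalizedModule q.primeCompl P₀ :=
    LinearEquiv.ofBijective (LocalizedModule.map q.primeCompl (LinearMap.ker f₀).subtype)
      ⟨LocalizedModule.map_injective _ _ (Submodule.injective_subtype _), fun y ↦
        (LocalizedModule.map_exact q.primeCompl _ _ hex₀ y).mp (Subsingleton.elim _ _)⟩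
  have : Module.Free (Localization.AtPrime q) (LocalizedModule q.primeCompl (LinearMap.ker f₀)) :=
    have : Module.Free (Localization.AtPrime q) (LocalizedModule q.primeCompl P₀) :=
      Module.free_of_flat_of_isLocalRing
    Module.Free.of_equiv e.symm
  have : Module.Free (Localization.AtPrime q) (LocalizedModule q.primeCompl (LinearMap.ker f₁)) :=
    Module.free_of_flat_of_isLocalRing
  have hrank : Module.rankAtStalk P₁ (⟨m, hm.isPrime⟩ : PrimeSpectrum R) =
      Module.rankAtStalk (LinearMap.ker f₁) (⟨m, hm.isPrime⟩ : PrimeSpectrum R) +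
        Module.rankAtStalk P₀ (⟨m, hm.isPrime⟩ : PrimeSpectrum R) := by
    have := hm.isPrime
    rw [← Module.rankAtStalk_eq_of_le_of_finite_of_flat' P₁ hqm.le,
      ← Module.rankAtStalk_eq_of_le_of_finite_of_flat' (LinearMap.ker f₁) hqm.le,
      ← Module.rankAtStalk_eq_of_le_of_finite_of_flat' P₀ hqm.le,
      rankAtStalk_eq_add_of_exact ⟨q, hq⟩ (Submodule.injective_subtype _) hf₁ hex₁]
    congr 1
    exact e.finrank_eq
  have hlen₀ := Module.length_eq_add_of_exact (LinearMap.lcomp R N f₀)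
    (LinearMap.lcomp R N (LinearMap.ker f₀).subtype) (LinearMap.lcomp_injective_of_surjective f₀ hf₀)
    (exists_comp_subtype_eq_of_subsingleton_ext_one f₀ hf₀ hext)
    (LinearMap.exact_lcomp_of_exact_of_surjective N hex₀ hf₀)
  have hlen₁ := length_le_add_of_exact 
    (LinearMap.lcomp_injective_of_surjective f₁ hf₁ : Function.Injective (LinearMap.lcomp R N f₁))
    (LinearMap.exact_lcomp_of_exact_of_surjective N hex₁ hf₁)
  have hpos : 0 < Module.length R (M →ₗ[R] N) := by
    have := (isFiniteLength_iff_isNoetherian_isArtinian.mp hN).1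
    have := hMm.nontrivial_linearMap hNm
    exact Module.length_pos
  rw [length_linearMap_eq_rankAtStalk_mul P₁ hN hNm,
    length_linearMap_eq_rankAtStalk_mul (LinearMap.ker f₁) hN hNm, hrank, Nat.cast_add, add_mul,
    add_comm, ← length_linearMap_eq_rankAtStalk_mul P₀ hN hNm] at hlen₁
  have hKfin : (Module.rankAtStalk (LinearMap.ker f₁) (⟨m, hm.isPrime⟩ : PrimeSpectrum R) : ℕ∞) *
      Module.length R N ≠ ⊤ :=
    WithTop.mul_ne_top (ENat.natCast_ne_top _) (Module.length_ne_top_iff.mpr hN)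
  have hfin : Module.length R (LinearMap.ker f₀ →ₗ[R] N) ≠ ⊤ := by
    have h : Module.length R (P₀ →ₗ[R] N) ≠ ⊤ := by
      rw [length_linearMap_eq_rankAtStalk_mul P₀ hN hNm]
      exact WithTop.mul_ne_top (ENat.natCast_ne_top _) (Module.length_ne_top_iff.mpr hN)
    rw [hlen₀] at h
    exact ne_top_of_le_ne_top h le_add_self
  rw [ENat.add_le_add_iff_right hKfin, hlen₀] at hlen₁
  exact (ENat.lt_add_left hfin hpos).not_ge hlen₁

end EulerCharacteristic

/-! ### Graded modules of finite length -/

section Graded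

variable {R : Type*} [CommRing R] (𝒜 : ℤ → AddSubgroup R)
  {M : Type*} [AddCommGroup M] [Module R M] (ℳ : ℤ → AddSubgroup M) [DirectSum.Decomposition ℳ]

open DirectSum

theorem coe_decompose_smul_of_mem [SetLike.GradedSMul 𝒜 ℳ] {d : ℤ} {x : R}
    (hx : x ∈ 𝒜 d) (v : M) (i : ℤ) :
    (decompose ℳ (x • v) (d + i) : M) = x • (decompose ℳ v i : M) := by
  induction v using Decomposition.inductionOn ℳ with
  | zero => simp
  | @homogeneous j v =>
    have hmem : x • (v : M) ∈ ℳ (d + j) := SetLike.GradedSMul.smul_mem hx v.2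
    by_cases h : j = i
    · subst h
      rw [decompose_of_mem_same ℳ hmem, decompose_of_mem_same ℳ v.2]
    · rw [decompose_of_mem_ne ℳ hmem (by simpa using h), decompose_of_mem_ne ℳ v.2 h, smul_zero]
  | add v w hv hw => simp [hv, hw]

/-- A homogeneous element `x` of nonzero degree acts nilpotently on a graded module of finite
length. Comparing components shows that `1 + x` is injective, hence surjective, and that
a preimage of a homogeneous `w` must be the geometric series `∑ (-x)ⁱ w`, which then is finite. -/
theorem exists_pow_mem_annihilator_of_mem [SetLike.GradedSMul 𝒜 ℳ] [IsNoetherian R M]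
    [IsArtinian R M] {d : ℤ} (hd : d ≠ 0)
    {x : R} (hx : x ∈ 𝒜 d) : ∃ k : ℕ, x ^ k ∈ Module.annihilator R M := by
  let φ : M →ₗ[R] M := LinearMap.id + LinearMap.lsmul R M x
  have hφ (v : M) (i : ℤ) : (decompose ℳ (φ v) i : M) =
      decompose ℳ v i + x • (decompose ℳ v (i - d) : M) := by
    rw [← coe_decompose_smul_of_mem 𝒜 ℳ hx, add_sub_cancel]
    simp [φ]
  have hfin (v : M) (i : ℤ) : ∃ k : ℕ, ∀ l ≥ k, (decompose ℳ v (i + l * d) : M) = 0 ∧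
      (decompose ℳ v (i - l * d) : M) = 0 := by
    classical
    obtain ⟨B, hB⟩ := ((decompose ℳ v).support.image fun j ↦ (j - i).natAbs).bddAbove
    have hz (j : ℤ) (hj : B < (j - i).natAbs) : (decompose ℳ v j : M) = 0 := by
      by_contra hc
      refine absurd (hB (Finset.mem_coe.mpr (Finset.mem_image_of_mem _ (a := j) ?_))) hj.not_ge
      rw [DFinsupp.mem_support_iff]
      exact fun h ↦ hc (by rw [h]; rfl)
    have hd1 : 1 ≤ d.natAbs := Int.natAbs_pos.mpr hd
    refine ⟨B + 1, fun l hl ↦ ⟨hz _ ?_, hz _ ?_⟩⟩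
    · rw [add_sub_cancel_left, Int.natAbs_mul, Int.natAbs_natCast]
      nlinarith
    · rw [sub_sub_cancel_left, Int.natAbs_neg, Int.natAbs_mul, Int.natAbs_natCast]
      nlinarith
  -- Components of `v` below those of `φ v` vanish.
  have hdown (v : M) (i : ℤ) (h : ∀ l : ℕ, (decompose ℳ (φ v) (i - l * d) : M) = 0) :
      (decompose ℳ v i : M) = 0 := by
    obtain ⟨k, hk⟩ := hfin v i
    have hs (l : ℕ) : (decompose ℳ v i : M) = (-x) ^ l • (decompose ℳ v (i - l * d) : M) := by
      induction l with
      | zero =>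
        have : i - ((0 : ℕ) : ℤ) * d = i := by simp
        rw [this, pow_zero, one_smul]
      | succ l ih =>
        have h1 := h l
        rw [hφ, add_eq_zero_iff_eq_neg, ← neg_smul] at h1
        have h2 : i - ((l + 1 : ℕ) : ℤ) * d = i - l * d - d := by
          push_cast
          ring
        rw [ih, h1, smul_smul, ← pow_succ, h2]
    rw [hs k, (hk k le_rfl).2, smul_zero]
  have hinj : Function.Injective φ := by
    rw [← LinearMap.ker_eq_bot, LinearMap.ker_eq_bot']
    intro v hv
    apply (decompose ℳ).injective
    ext i
    rw [hdown v i fun l ↦ by simp [hv]]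
    simp
  have hsurj := IsArtinian.surjective_of_injective_endomorphism φ hinj
  have hnil (j : ℤ) (w : M) (hw : w ∈ ℳ j) : ∃ k : ℕ, x ^ k • w = 0 := by
    obtain ⟨v, rfl⟩ := hsurj w
    obtain ⟨k, hk⟩ := hfin v j
    have h0 : (decompose ℳ v (j - d) : M) = 0 := by
      refine hdown v _ fun l ↦ decompose_of_mem_ne ℳ hw ?_
      have : (l + 1 : ℤ) * d ≠ 0 := mul_ne_zero (by positivity) hd
      intro h
      apply this
      linarith
    have hj : (decompose ℳ v j : M) = φ v := by
      have := hφ v j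
      rwa [h0, smul_zero, add_zero, decompose_of_mem_same ℳ hw, eq_comm] at this
    have hs (l : ℕ) : (decompose ℳ v (j + l * d) : M) = (-x) ^ l • φ v := by
      induction l with
      | zero =>
        have : j + ((0 : ℕ) : ℤ) * d = j := by simp
        rw [this, hj, pow_zero, one_smul]
      | succ l ih =>
        have h1 := hφ v (j + (l + 1 : ℕ) * d)
        have h2 : j + ((l + 1 : ℕ) : ℤ) * d - d = j + l * d := by push_cast; ring
        have h3 : j ≠ j + ((l + 1 : ℕ) : ℤ) * d := by
          simpa using ⟨by positivity, hd⟩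
        rw [h2, ih, decompose_of_mem_ne ℳ hw h3, eq_comm, add_eq_zero_iff_eq_neg, ← neg_smul,
          smul_smul, ← pow_succ'] at h1
        exact h1
    refine ⟨k, ?_⟩
    have := (hs k).symm.trans (hk k le_rfl).1
    rw [neg_pow, mul_smul] at this
    exact ((isUnit_neg_one.pow k).smul_eq_zero).mp this
  have hpow (k : ℕ) (v : M) : ((LinearMap.lsmul R M x) ^ k) v = x ^ k • v := by
    induction k with
    | zero => simp
    | succ k ih => rw [pow_succ', Module.End.mul_apply, ih, pow_succ', mul_smul]; rfl
  obtain ⟨k, hk⟩ : IsNilpotent (LinearMap.lsmul R M x) := by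
    rw [Module.End.isNilpotent_iff_of_finite]
    intro v
    induction v using Decomposition.inductionOn ℳ with
    | zero => exact ⟨0, by simp⟩
    | @homogeneous j v =>
      obtain ⟨k, hk⟩ := hnil j v v.2
      exact ⟨k, by rw [hpow, hk]⟩
    | add v w hv hw =>
      obtain ⟨k, hk⟩ := hv
      obtain ⟨l, hl⟩ := hw
      refine ⟨k + l, ?_⟩
      rw [hpow] at hk hl
      rw [hpow, smul_add, pow_add, mul_smul _ _ w, hl, mul_comm, mul_smul, hk, smul_zero,
        smul_zero, add_zero]
  exact ⟨k, Module.mem_annihilator.mpr fun v ↦ by rw [← hpow, hk, LinearMap.zero_apply]⟩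

/-- The annihilator of an Artinian Noetherian module is contained in no nonmaximal prime. -/
theorem Ideal.IsPrime.isMaximal_of_annihilator_le [IsNoetherian R M] [IsArtinian R M] {P : Ideal R}
    (hP : P.IsPrime) (h : Module.annihilator R M ≤ P) : P.IsMaximal := by
  obtain ⟨n, g, hg⟩ := Module.Finite.exists_fin' R M
  let φ : R →ₗ[R] Fin n → M := LinearMap.pi fun i ↦
    LinearMap.toSpanSingleton R M (g (Pi.single i 1))
  have hφ : LinearMap.ker φ ≤ P := by
    refine le_trans (fun r hr ↦ Module.mem_annihilator.mpr fun v ↦ ?_) h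
    obtain ⟨w, rfl⟩ := hg v
    have hr' (i : Fin n) : r • g (Pi.single i 1) = 0 := congr_fun (LinearMap.mem_ker.mp hr) i
    have : LinearMap.lsmul R M r ∘ₗ g = 0 := by
      ext i
      simpa using hr' i
    exact LinearMap.congr_fun this w
  have h1 : IsArtinian R (R ⧸ LinearMap.ker φ) :=
    isArtinian_of_injective _ (LinearMap.ker_eq_bot.mp (Submodule.ker_liftQ_eq_bot' _ φ rfl))
  have h2 : IsArtinian R (R ⧸ P) :=
    isArtinian_of_surjective _ (Submodule.mapQ _ P LinearMap.id hφ) fun y ↦ by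
      obtain ⟨y, rfl⟩ := Submodule.mkQ_surjective _ y
      exact ⟨Submodule.Quotient.mk y, rfl⟩
  have : IsArtinianRing (R ⧸ P) := isArtinian_of_tower R h2
  exact Ideal.Quotient.maximal_of_isField P (IsArtinianRing.isField_of_isDomain _)

/-- A prime ideal containing the annihilator of a graded module of finite length contains all
homogeneous elements of nonzero degree, and therefore is homogeneous. -/
theorem isHomogeneous_of_annihilator_le [GradedRing 𝒜] [SetLike.GradedSMul 𝒜 ℳ]
    [IsNoetherian R M] [IsArtinian R M]
    {P : Ideal R} (hP : P.IsPrime) (h : Module.annihilator R M ≤ P) : P.IsHomogeneous 𝒜 := by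
  classical
  have hne {d : ℤ} (hd : d ≠ 0) {x : R} (hx : x ∈ 𝒜 d) : x ∈ P := by
    obtain ⟨k, hk⟩ := exists_pow_mem_annihilator_of_mem 𝒜 ℳ hd hx
    exact hP.mem_of_pow_mem k (h hk)
  intro i r hr
  by_cases hi : i = 0
  · subst hi
    have hsum : (decompose 𝒜 r 0 : R) +
        ∑ j ∈ (decompose 𝒜 r).support.erase 0, (decompose 𝒜 r j : R) = r := by
      rw [← Finset.sum_insert (f := fun j ↦ (decompose 𝒜 r j : R)) (Finset.notMem_erase 0 _)]
      conv_rhs => rw [← sum_support_decompose 𝒜 r]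
      symm
      refine Finset.sum_subset (fun j hj ↦ ?_) fun j _ hj ↦ ?_
      · by_cases h : j = 0 <;> simp_all
      · simpa using hj
    have := P.sum_mem fun j (hj : j ∈ (decompose 𝒜 r).support.erase 0) ↦
      hne (Finset.ne_of_mem_erase hj) (decompose 𝒜 r j).2
    rw [← hsum] at hr
    exact (Ideal.add_mem_iff_left P this).mp hr
  · exact hne hi (decompose 𝒜 r i).2

theorem isSupportedAt_of_isMaximal_isHomogeneous_imp [GradedRing 𝒜] [SetLike.GradedSMul 𝒜 ℳ]
    (hM : IsFiniteLength R M) {m : Ideal R}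
    (hm : ∀ P : Ideal R, P.IsMaximal ∧ P.IsHomogeneous 𝒜 → P = m) :
    IsSupportedAt m M := fun P hP hle ↦ by
  obtain ⟨_, _⟩ := isFiniteLength_iff_isNoetherian_isArtinian.mp hM
  exact hm P ⟨hP.isMaximal_of_annihilator_le hle, isHomogeneous_of_annihilator_le 𝒜 ℳ hP hle⟩

end Graded

/-! ### Nonvanishing of `Ext` -/

/-- A module supported at a minimal prime `m` that is maximal has projective dimension at most
zero or infinite; so a finite module of positive finite projective dimension forces a prime
strictly below `m`. -/
theorem IsSupportedAt.exists_lt_of_not_hasProjectiveDimensionLE_zero {R : Type u} [CommRing R]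
    [IsNoetherianRing R] {m : Ideal R} [hm : m.IsMaximal] {M : Type u} [AddCommGroup M]
    [Module R M] [Module.Finite R M] (h : IsSupportedAt m M) {p : ℕ}
    (hM : HasProjectiveDimensionLE (ModuleCat.of R M) p)
    (hM0 : ¬ HasProjectiveDimensionLE (ModuleCat.of R M) 0) :
    ∃ q : Ideal R, q.IsPrime ∧ q < m := by
  by_contra! hc
  refine hM0 (h.hasProjectiveDimensionLE_of_ringKrullDim_le ?_ hM)
  have hmin : m ∈ minimalPrimes R := by
    refine ⟨⟨hm.isPrime, bot_le⟩, fun q hq hqm ↦ ?_⟩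
    by_contra hlt
    exact hc q hq.1 (lt_of_le_not_ge hqm hlt)
  rw [IsLocalization.AtPrime.ringKrullDim_eq_height m, Ideal.height_eq_zero_iff.mpr hmin]
  rfl

theorem mainTheorem5 {R : Type u} [CommRing R] [IsNoetherianRing R]
    (𝒜 : ℤ → AddSubgroup R) [GradedRing 𝒜] [IsArtinianRing (𝒜 0)]
    (hdim : ringKrullDim R ≤ 2)
    (hmax : ∃! m : Ideal R, m.IsMaximal ∧ m.IsHomogeneous 𝒜)
    {M : Type u} [AddCommGroup M] [Module R M] [Nontrivial M]
    (ℳ : ℤ → AddSubgroup M) [DirectSum.Decomposition ℳ] [SetLike.GradedSMul 𝒜 ℳ]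
    (hM : IsFiniteLength R M)
    {N : Type u} [AddCommGroup N] [Module R N] [Nontrivial N]
    (𝒩 : ℤ → AddSubgroup N) [DirectSum.Decomposition 𝒩] [SetLike.GradedSMul 𝒜 𝒩]
    (hN : IsFiniteLength R N)
    (hpd : projectiveDimension (ModuleCat.of R M) < ⊤)
    (n : ℕ) (hn : (n : WithBot ℕ∞) ≤ projectiveDimension (ModuleCat.of R M)) :
    Nontrivial (Abelian.Ext (ModuleCat.of R M) (ModuleCat.of R N) n) := by
  obtain ⟨m, ⟨hm, -⟩, hmuniq⟩ := hmax
  have hMm : IsSupportedAt m M := isSupportedAt_of_isMaximal_isHomogeneous_imp 𝒜 ℳ hM hmuniq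
  have hNm : IsSupportedAt m N := isSupportedAt_of_isMaximal_isHomogeneous_imp 𝒜 𝒩 hN hmuniq
  have := (isFiniteLength_iff_isNoetherian_isArtinian.mp hM).1
  have := (isFiniteLength_iff_isNoetherian_isArtinian.mp hN).1
  obtain ⟨q, hq⟩ := (projectiveDimension_ne_top_iff _).mp hpd.ne
  have hdim_m : ringKrullDim (Localization.AtPrime m) ≤ (2 : ℕ) :=
    (IsLocalization.AtPrime.ringKrullDim_eq_height m _).trans_le
      (Ideal.height_le_ringKrullDim_of_ne_top hm.ne_top |>.trans hdim)
  have h2 := hMm.hasProjectiveDimensionLE_of_ringKrullDim_le hdim_m hq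
  have hnlt : ¬ HasProjectiveDimensionLT (ModuleCat.of R M) n :=
    (projectiveDimension_ge_iff _ n).mp hn
  by_cases hn' : HasProjectiveDimensionLE (ModuleCat.of R M) n
  · exact nontrivial_ext_of_isSupportedAt hMm hn' hnlt hNm
  -- Now `n` is smaller than the projective dimension, which is at most two.
  have hn2 : n < 2 := by
    by_contra! h
    exact hn' (hasProjectiveDimensionLT_of_ge _ _ _ (Nat.succ_le_succ h))
  interval_cases n
  · have := hMm.nontrivial_linearMap hNm
    exact (Ext.homEquiv₀.trans ModuleCat.homEquiv).nontrivial
  · obtain ⟨p, hp, hpm⟩ := hMm.exists_lt_of_not_hasProjectiveDimensionLE_zero h2 hnlt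
    exact nontrivial_ext_one_of_hasProjectiveDimensionLE_two hpm hMm hNm hN h2
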